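/- Let $P, Q$ be complex polynomials in one variable of degrees $\ge 2$ with $P(0)=Q(0)=0$, $0<|P'(0)|<1$ and $0<|Q'(0)|<1$, and let $F:\mathbb{C}^2\to\mathbb{C}^2$, $F(z,w)=(P(z),Q(w))$. Let $\Omega$ be the immediate basin of attraction of $(0,0)$, that is, the connected component containing $(0,0)$ of the basin $\{x\in\mathbb{C}^2 : F^n(x)\to(0,0) \text{ as } n\to\infty\}$. Let $d_\Omega$ be the Kobayashi distance on $\Omega$: with $\triangle$ the open unit disk and, for $x\in\Omega$, $\xi\in\mathbb{C}^2$, $$K_\Omega(x,\xi)=\inf\{\lambda>0 : \exists f:\triangle\to\Omega \text{ holomorphic},\ f(0)=x,\ \lambda f'(0)=\xi\},$$ $d_\Omega(x,y)$ is the infimum of $\int_0^1 K_\Omega(\gamma(t),\gamma'(t))\,dt$ over all piecewise smooth curves $\gamma:[0,1]\to\Omega$ from $x$ to $y$. Then there is a constant $C<\infty$ (depending only on $P$ and $Q$) such that for every $(z_0,w_0)\in\Omega$ there is a point $(\tilde z,\tilde w)\in\Omega\cap\bigcup_{k\ge 0}F^{-k}(0,0)$ with $$d_\Omega\big((z_0,w_0),(\tilde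 z,\tilde w)\big)\le C.$$ -/

import Mathlib

open Set Filter Topology
open scoped NNReal ENNReal ContDiff

noncomputable section

/-- The Kobayashi (Royden) infinitesimal metric of `Ω` at the point `z` in the direction `ξ`: the
infimum of the `r > 0` for which there is a holomorphic map `f` from the open unit disk into `Ω`
with `f 0 = z` and `r f'(0) = ξ` (it is `∞` if there is no such `r`, e.g. if `z ∉ Ω`). -/
def kobayashiMetric {E : Type*} [NormedAddCommGroup E] [NormedSpace ℂ E]
    (Ω : Set E) (z ξ : E) : ℝ≥0∞ :=
  sInf {a : ℝ≥0∞ | ∃ r : ℝ, 0 < r ∧ a = ENNReal.ofReal r ∧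
    ∃ f : ℂ → E, DifferentiableOn ℂ f (Metric.ball 0 1) ∧ MapsTo f (Metric.ball 0 1) Ω ∧
      f 0 = z ∧ (r : ℂ) • deriv f 0 = ξ}

/-- `γ` restricted to `[0, 1]` is continuous, and there is a partition
`0 = t₀ < t₁ < ⋯ < tₙ = 1` such that `γ` is smooth on each closed interval `[tᵢ, tᵢ₊₁]`. -/
def IsPiecewiseSmooth {E : Type*} [NormedAddCommGroup E] [NormedSpace ℂ E]
    (γ : ℝ → E) : Prop :=
  ContinuousOn γ (Icc 0 1) ∧
    ∃ (n : ℕ) (t : Fin (n + 1) → ℝ), StrictMono t ∧ t 0 = 0 ∧ t (Fin.last n) = 1 ∧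
      ∀ i : Fin n, ContDiffOn ℝ ∞ γ (Icc (t i.castSucc) (t i.succ))

/-- The Kobayashi length of the curve `γ : [0, 1] → Ω`. -/
def kobayashiLength {E : Type*} [NormedAddCommGroup E] [NormedSpace ℂ E]
    (Ω : Set E) (γ : ℝ → E) : ℝ≥0∞ :=
  ∫⁻ t in Icc (0 : ℝ) 1, kobayashiMetric Ω (γ t) (deriv γ t)

/-- The Kobayashi distance on `Ω`: the infimum of the Kobayashi lengths of the piecewise smooth
curves in `Ω` from `p` to `q` (it is `∞` if there is no such curve). -/
def kobayashiDist {E : Type*} [NormedAddCommGroup E] [NormedSpace ℂ E]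
    (Ω : Set E) (p q : E) : ℝ≥0∞ :=
  sInf {a : ℝ≥0∞ | ∃ γ : ℝ → E, IsPiecewiseSmooth γ ∧ MapsTo γ (Icc 0 1) Ω ∧
    γ 0 = p ∧ γ 1 = q ∧ a = kobayashiLength Ω γ}

/-- The basin of attraction of `p`: the points whose orbit under `F` converges to `p`. -/
def attractingBasin {X : Type*} [TopologicalSpace X] (F : X → X) (p : X) : Set X :=
  {x | Tendsto (fun n : ℕ => F^[n] x) atTop (𝓝 p)}

/-- The immediate basin of `p`: the connected component of the basin of attraction containing
`p`. -/
def immediateBasin {X : Type*} [TopologicalSpace X] (F : X → X) (p : X) : Set X :=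
  connectedComponentIn (attractingBasin F p) p

/-- The backward orbit `⋃_{k ≥ 0} F^{-k}(p)`. -/
def backwardOrbit {X : Type*} (F : X → X) (p : X) : Set X :=
  ⋃ k : ℕ, F^[k] ⁻¹' {p}

/-- The product map `(z, w) ↦ (P(z), Q(w))` of `ℂ²`. -/
def productMap (P Q : Polynomial ℂ) (x : ℂ × ℂ) : ℂ × ℂ :=
  (P.eval x.1, Q.eval x.2)

end

/-! The immediate basin of the product map is the product of the two one-variable immediate basins,
and distances are bounded by chains of holomorphic disks, each link costing at most 1. Thus it
suffices to join every point of a one-variable basin `Ω` of `f = P` to an iterated preimage of `0`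
by boundedly many disks (`exists_discChain_to_backwardOrbit`).

The critical values in the basin of all iterates `f^k` lie in one countable compact set `S`, so `S ⊆
G = {‖f^M‖ < r}` for a small trapping radius `r` and some `M`. Points of `G ∩ Ω` have relatively
compact range in `Ω` and are joined to `0`. Any other point `z` has an iterate `f^k z` outside `G`
with `f^(k+1) z` in `G`, hence in a compact part of `Ω \ S`. This set is connected, so a chain of
bounded length in it joins `f^k z` to a fixed `a ∉ G` in the backward orbit of `0`. It avoids the
critical values of `f^k`, so it lifts to a chain from `z` of the same length.

Such an `a` exists because `Ω` contains a zero `b ≠ 0` of `P` (`exists_ne_zero_eval_eq_zero`):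
otherwise the maximum principle for `z / f^m z` would bound `P'(0)^(-m)` uniformly in `m`. -/

section Kobayashi

/-! ### Concatenation of curves and the triangle inequality. -/

/-- The curve running through `γ₁` at double speed and then through `γ₂` at double speed. -/
noncomputable def concatCurve {X : Type*} (γ₁ γ₂ : ℝ → X) (x : ℝ) : X :=
  if x ≤ 1 / 2 then γ₁ (2 * x) else γ₂ (2 * x - 1)

theorem concatCurve_eqOn_left {X : Type*} (γ₁ γ₂ : ℝ → X) :
    EqOn (concatCurve γ₁ γ₂) (fun x => γ₁ (2 * x)) (Iic (1 / 2)) := fun _ hx =>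
  if_pos (mem_Iic.1 hx)

theorem concatCurve_eqOn_right {X : Type*} {γ₁ γ₂ : ℝ → X} (h : γ₁ 1 = γ₂ 0) :
    EqOn (concatCurve γ₁ γ₂) (fun x => γ₂ (2 * x - 1)) (Ici (1 / 2)) := fun x hx => by
  rcases eq_or_lt_of_le (mem_Ici.1 hx) with rfl | hlt
  · simp [concatCurve, h]
  · simp only [concatCurve, not_le.2 hlt, if_false]

variable {E : Type*} [NormedAddCommGroup E] [NormedSpace ℂ E]

theorem kobayashiMetric_le_of_disc {Ω : Set E} {z ξ : E} {r : ℝ} (hr : 0 < r) {f : ℂ → E}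
    (hf : DifferentiableOn ℂ f (Metric.ball 0 1)) (hfΩ : MapsTo f (Metric.ball 0 1) Ω)
    (h0 : f 0 = z) (h1 : (r : ℂ) • deriv f 0 = ξ) :
    kobayashiMetric Ω z ξ ≤ ENNReal.ofReal r :=
  sInf_le ⟨r, hr, rfl, f, hf, hfΩ, h0, h1⟩

theorem kobayashiMetric_smul_le (Ω : Set E) (z ξ : E) {c : ℝ} (hc : 0 < c) :
    kobayashiMetric Ω z ((c : ℂ) • ξ) ≤ ENNReal.ofReal c * kobayashiMetric Ω z ξ := by
  have hc0 : ENNReal.ofReal c ≠ 0 := by simpa using hc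
  rw [mul_comm, ← ENNReal.div_le_iff hc0 ENNReal.ofReal_ne_top]
  refine le_sInf ?_
  rintro a ⟨r, hr, rfl, f, hf, hfΩ, h0, h1⟩
  rw [ENNReal.div_le_iff hc0 ENNReal.ofReal_ne_top, ← ENNReal.ofReal_mul hr.le]
  refine kobayashiMetric_le_of_disc (mul_pos hr hc) hf hfΩ h0 ?_
  rw [← h1, smul_smul, mul_comm r c]
  push_cast
  rfl

theorem IsPiecewiseSmooth.concatCurve {γ₁ γ₂ : ℝ → E} (h₁ : IsPiecewiseSmooth γ₁)
    (h₂ : IsPiecewiseSmooth γ₂) (h : γ₁ 1 = γ₂ 0) :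
    IsPiecewiseSmooth (concatCurve γ₁ γ₂) := by
  obtain ⟨c₁, n, t, ht, ht0, ht1, hts⟩ := h₁
  obtain ⟨c₂, m, s, hs, hs0, hs1, hss⟩ := h₂
  have hsplit : Icc (0 : ℝ) 1 = Icc 0 (1 / 2) ∪ Icc (1 / 2) 1 :=
    (Icc_union_Icc_eq_Icc (by norm_num) (by norm_num)).symm
  refine ⟨?_, n + m, fun i => if hi : i.val ≤ n then t ⟨i, by omega⟩ / 2
    else (1 + s ⟨i - n, by omega⟩) / 2, ?_⟩
  · rw [hsplit]
    refine ContinuousOn.union_of_isClosed ?_ ?_ isClosed_Icc isClosed_Icc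
    · refine ContinuousOn.congr (f := fun x => γ₁ (2 * x)) ?_
        ((concatCurve_eqOn_left γ₁ γ₂).mono Icc_subset_Iic_self)
      refine c₁.comp (by fun_prop) fun x hx => ?_
      simp only [mem_Icc] at hx ⊢
      constructor <;> linarith
    · refine ContinuousOn.congr (f := fun x => γ₂ (2 * x - 1)) ?_
        ((concatCurve_eqOn_right h).mono Icc_subset_Ici_self)
      refine c₂.comp (by fun_prop) fun x hx => ?_
      simp only [mem_Icc] at hx ⊢
      constructor <;> linarith
  set u : Fin (n + m + 1) → ℝ := fun i => if hi : i.val ≤ n then t ⟨i, by omega⟩ / 2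
    else (1 + s ⟨i - n, by omega⟩) / 2 with hu
  have hu1 : ∀ (i : Fin (n + m + 1)) (k : Fin (n + 1)), i.val = k.val → u i = t k / 2 := by
    intro i k hik
    have : i.val ≤ n := by omega
    simp only [hu, this, dif_pos]
    congr 2
    ext
    exact hik
  have hu2 : ∀ (i : Fin (n + m + 1)) (k : Fin (m + 1)), i.val = n + k.val →
      u i = (1 + s k) / 2 := by
    intro i k hik
    -- At the shared node `i = n` the first branch of `u` applies; both formulas give `1 / 2` there.
    by_cases hk : k.val = 0
    · have hk0 : k = 0 := Fin.ext hk
      rw [hu1 i (Fin.last n) (by simp [hik, hk]), ht1, hk0, hs0]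
      norm_num
    · have : ¬ i.val ≤ n := by omega
      simp only [hu, this, dif_neg, not_false_eq_true]
      congr 3
      ext
      simp [hik]
  have ht_mem : ∀ k, t k ∈ Icc (0 : ℝ) 1 := fun k =>
    ⟨ht0 ▸ ht.monotone (Fin.zero_le k), ht1 ▸ ht.monotone (Fin.le_last k)⟩
  have hs_mem : ∀ k, s k ∈ Icc (0 : ℝ) 1 := fun k =>
    ⟨hs0 ▸ hs.monotone (Fin.zero_le k), hs1 ▸ hs.monotone (Fin.le_last k)⟩
  refine ⟨?_, ?_, ?_, ?_⟩
  · rw [Fin.strictMono_iff_lt_succ]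
    intro i
    by_cases hi : i.val < n
    · rw [hu1 i.castSucc (Fin.castSucc ⟨i, hi⟩) rfl, hu1 i.succ (Fin.succ ⟨i, hi⟩) rfl]
      have := ht (Fin.castSucc_lt_succ (i := ⟨i.val, hi⟩))
      linarith
    · have him : i.val - n < m := by omega
      rw [hu2 i.castSucc (Fin.castSucc ⟨i - n, him⟩) (by simp; omega),
        hu2 i.succ (Fin.succ ⟨i - n, him⟩) (by simp; omega)]
      have := hs (Fin.castSucc_lt_succ (i := ⟨i.val - n, him⟩))
      linarith
  · rw [hu1 0 0 rfl, ht0, zero_div]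
  · rw [hu2 (Fin.last _) (Fin.last m) (by simp), hs1]
    norm_num
  · intro i
    by_cases hi : i.val < n
    · rw [hu1 i.castSucc (Fin.castSucc ⟨i, hi⟩) rfl, hu1 i.succ (Fin.succ ⟨i, hi⟩) rfl]
      refine ContDiffOn.congr (f := fun x => γ₁ (2 * x)) ?_
        ((concatCurve_eqOn_left γ₁ γ₂).mono ?_)
      · refine (hts ⟨i, hi⟩).comp (by fun_prop) fun x hx => ?_
        simp only [mem_Icc] at hx ⊢
        constructor <;> linarith
      · intro x hx
        have := (ht_mem (Fin.succ ⟨i, hi⟩)).2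
        simp only [mem_Icc, mem_Iic] at hx ⊢
        linarith
    · have him : i.val - n < m := by omega
      rw [hu2 i.castSucc (Fin.castSucc ⟨i - n, him⟩) (by simp; omega),
        hu2 i.succ (Fin.succ ⟨i - n, him⟩) (by simp; omega)]
      refine ContDiffOn.congr (f := fun x => γ₂ (2 * x - 1)) ?_
        ((concatCurve_eqOn_right h).mono ?_)
      · refine (hss ⟨i - n, him⟩).comp (by fun_prop) fun x hx => ?_
        simp only [mem_Icc] at hx ⊢
        constructor <;> linarith
      · intro x hx
        have := (hs_mem (Fin.castSucc ⟨i - n, him⟩)).1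
        simp only [mem_Icc, mem_Ici] at hx ⊢
        linarith

/-- The Kobayashi length of an affine reparametrization, at speed two, of a piece of curve. -/
theorem lintegral_kobayashiMetric_reparam_le (Ω : Set E) (γ : ℝ → E) (c : ℝ) {s : Set ℝ}
    (hs : MeasurableSet s) (hs' : ∀ x ∈ s, 2 * x - c ∈ Icc (0 : ℝ) 1) :
    ∫⁻ x in s, kobayashiMetric Ω (γ (2 * x - c)) (deriv (fun y => γ (2 * y - c)) x) ≤
      kobayashiLength Ω γ := by
  have hder : ∀ x, deriv (fun y => γ (2 * y - c)) x = ((2 : ℝ) : ℂ) • deriv γ (2 * x - c) := by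
    intro x
    have h1 := deriv_comp_mul_left (2 : ℝ) (fun y => γ (y - c)) x
    rw [deriv_comp_sub_const] at h1
    rw [h1]
    norm_num [two_smul]
  calc ∫⁻ x in s, kobayashiMetric Ω (γ (2 * x - c)) (deriv (fun y => γ (2 * y - c)) x)
      ≤ ∫⁻ x in s, ENNReal.ofReal |2| *
          kobayashiMetric Ω (γ (2 * x - c)) (deriv γ (2 * x - c)) := by
        refine MeasureTheory.lintegral_mono fun x => ?_
        rw [hder, abs_two]
        exact kobayashiMetric_smul_le Ω _ _ two_pos
    -- This change of variables asks no measurability of the integrand, so none is needed for the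
    -- Kobayashi metric.
    _ = ∫⁻ y in (fun x => 2 * x - c) '' s, kobayashiMetric Ω (γ y) (deriv γ y) := by
        rw [MeasureTheory.lintegral_image_eq_lintegral_abs_deriv_mul (f := fun x => 2 * x - c)
          (f' := fun _ => 2) hs]
        · intro x _
          simpa using (((hasDerivAt_id x).const_mul 2).sub_const c).hasDerivWithinAt
        · intro x _ y _ hxy
          simpa using hxy
    _ ≤ kobayashiLength Ω γ :=
        MeasureTheory.lintegral_mono_set (by rintro _ ⟨x, hx, rfl⟩; exact hs' x hx)

theorem kobayashiLength_concatCurve_le (Ω : Set E) (γ₁ γ₂ : ℝ → E) :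
    kobayashiLength Ω (concatCurve γ₁ γ₂) ≤ kobayashiLength Ω γ₁ + kobayashiLength Ω γ₂ := by
  set g : ℝ → ℝ≥0∞ := fun t =>
    kobayashiMetric Ω (concatCurve γ₁ γ₂ t) (deriv (concatCurve γ₁ γ₂) t) with hg
  -- The derivative is not controlled at the joint `1 / 2`; off three points the concatenation
  -- agrees locally with one reparametrized piece.
  have hsub : Icc (0 : ℝ) 1 ⊆ (Ioo 0 (1 / 2) ∪ Ioo (1 / 2) 1) ∪ {0, 1 / 2, 1} := by
    rintro x ⟨h0, h1⟩
    simp only [mem_union, mem_Ioo, mem_insert_iff, mem_singleton_iff]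
    rcases h0.eq_or_lt with h | h
    · exact Or.inr (Or.inl h.symm)
    rcases h1.eq_or_lt with h' | h'
    · exact Or.inr (Or.inr (Or.inr h'))
    rcases lt_trichotomy x (1 / 2) with h2 | h2 | h2
    · exact Or.inl (Or.inl ⟨h, h2⟩)
    · exact Or.inr (Or.inr (Or.inl h2))
    · exact Or.inl (Or.inr ⟨h2, h'⟩)
  have hnull : ∫⁻ t in ({0, 1 / 2, 1} : Set ℝ), g t = 0 :=
    MeasureTheory.setLIntegral_measure_zero _ _
      ((Set.toFinite ({0, 1 / 2, 1} : Set ℝ)).measure_zero _)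
  have hleft : ∫⁻ t in Ioo (0 : ℝ) (1 / 2), g t ≤ kobayashiLength Ω γ₁ := by
    refine le_trans (le_of_eq ?_)
      (lintegral_kobayashiMetric_reparam_le Ω γ₁ 0 (s := Ioo 0 (1 / 2)) measurableSet_Ioo ?_)
    · refine MeasureTheory.setLIntegral_congr_fun measurableSet_Ioo fun x hx => ?_
      have he : concatCurve γ₁ γ₂ =ᶠ[𝓝 x] fun y => γ₁ (2 * y - 0) := by
        filter_upwards [Iio_mem_nhds hx.2] with y hy
        simpa using concatCurve_eqOn_left γ₁ γ₂ (mem_Iic.2 (le_of_lt hy))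
      simp only [hg, he.eq_of_nhds, he.deriv_eq]
    · rintro x ⟨h0, h1⟩
      constructor <;> linarith
  have hright : ∫⁻ t in Ioo (1 / 2 : ℝ) 1, g t ≤ kobayashiLength Ω γ₂ := by
    refine le_trans (le_of_eq ?_)
      (lintegral_kobayashiMetric_reparam_le Ω γ₂ 1 (s := Ioo (1 / 2) 1) measurableSet_Ioo ?_)
    · refine MeasureTheory.setLIntegral_congr_fun measurableSet_Ioo fun x hx => ?_
      have he : concatCurve γ₁ γ₂ =ᶠ[𝓝 x] fun y => γ₂ (2 * y - 1) := by
        filter_upwards [Ioi_mem_nhds hx.1] with y hy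
        simp only [concatCurve, not_le.2 (mem_Ioi.1 hy), if_false]
      simp only [hg, he.eq_of_nhds, he.deriv_eq]
    · rintro x ⟨h0, h1⟩
      constructor <;> linarith
  calc kobayashiLength Ω (concatCurve γ₁ γ₂) = ∫⁻ t in Icc (0 : ℝ) 1, g t := rfl
    _ ≤ ∫⁻ t in (Ioo (0 : ℝ) (1 / 2) ∪ Ioo (1 / 2) 1) ∪ {0, 1 / 2, 1}, g t :=
        MeasureTheory.lintegral_mono_set hsub
    _ ≤ (∫⁻ t in Ioo (0 : ℝ) (1 / 2) ∪ Ioo (1 / 2) 1, g t) +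
          ∫⁻ t in ({0, 1 / 2, 1} : Set ℝ), g t :=
        MeasureTheory.lintegral_union_le _ _ _
    _ ≤ ((∫⁻ t in Ioo (0 : ℝ) (1 / 2), g t) + ∫⁻ t in Ioo (1 / 2 : ℝ) 1, g t) + 0 := by
        rw [hnull]
        gcongr
        exact MeasureTheory.lintegral_union_le _ _ _
    _ ≤ kobayashiLength Ω γ₁ + kobayashiLength Ω γ₂ := by
        rw [add_zero]
        gcongr

theorem kobayashiDist_triangle (Ω : Set E) (p q r : E) :
    kobayashiDist Ω p r ≤ kobayashiDist Ω p q + kobayashiDist Ω q r := by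
  simp only [kobayashiDist]
  rw [ENNReal.sInf_add]
  refine le_iInf₂ fun a ha => ?_
  rw [add_comm, ENNReal.sInf_add]
  refine le_iInf₂ fun b hb => ?_
  obtain ⟨γ₁, hs₁, hΩ₁, h₁0, h₁1, rfl⟩ := ha
  obtain ⟨γ₂, hs₂, hΩ₂, h₂0, h₂1, rfl⟩ := hb
  have hglue : γ₁ 1 = γ₂ 0 := h₁1.trans h₂0.symm
  rw [add_comm]
  refine le_trans (sInf_le ⟨concatCurve γ₁ γ₂, hs₁.concatCurve hs₂ hglue, ?_, ?_, ?_, rfl⟩)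
    (kobayashiLength_concatCurve_le Ω γ₁ γ₂)
  · rintro x ⟨hx0, hx1⟩
    simp only [concatCurve]
    split_ifs with hx
    · exact hΩ₁ ⟨by linarith, by linarith⟩
    · exact hΩ₂ ⟨by linarith, by linarith⟩
  · simp [concatCurve, h₁0]
  · norm_num [concatCurve, h₂1]

/-! ### Chains of holomorphic disks. -/

/-- `q` lies on a holomorphic disk in `Ω` centred at `p`, at parameter of modulus at most `1/2`. -/
def DiscLinked (Ω : Set E) (p q : E) : Prop :=
  ∃ f : ℂ → E, DifferentiableOn ℂ f (Metric.ball 0 1) ∧ MapsTo f (Metric.ball 0 1) Ω ∧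
    f 0 = p ∧ ∃ s : ℂ, ‖s‖ ≤ 1 / 2 ∧ f s = q

/-- `p` and `q` are joined by a chain of `n` linked disks in `Ω`. -/
inductive DiscChain (Ω : Set E) : ℕ → E → E → Prop
  | nil (p : E) : DiscChain Ω 0 p p
  | cons {n : ℕ} {p q r : E} : DiscLinked Ω p q → DiscChain Ω n q r → DiscChain Ω (n + 1) p r

theorem DiscLinked.refl {Ω : Set E} {p : E} (hp : p ∈ Ω) : DiscLinked Ω p p :=
  ⟨fun _ => p, differentiableOn_const p, fun _ _ => hp, rfl, 0, by norm_num, rfl⟩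

theorem DiscLinked.mem_right {Ω : Set E} {p q : E} (h : DiscLinked Ω p q) : q ∈ Ω := by
  obtain ⟨f, _, hm, _, s, hs, rfl⟩ := h
  exact hm (by simp; linarith)

theorem DiscChain.trans {Ω : Set E} {n m : ℕ} {p q r : E} (h₁ : DiscChain Ω n p q)
    (h₂ : DiscChain Ω m q r) : DiscChain Ω (m + n) p r := by
  induction h₁ with
  | nil p => exact h₂
  | cons hl _ ih => exact .cons hl (ih h₂)

theorem DiscChain.mono {Ω : Set E} {n m : ℕ} {p q : E} (h : DiscChain Ω n p q) (hp : p ∈ Ω)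
    (hnm : n ≤ m) : DiscChain Ω m p q := by
  induction hnm with
  | refl => exact h
  | step _ ih => exact .cons (.refl hp) ih

/-- The curve is the image of the segment from `0` to `s`. As `‖s‖ ≤ 1 / 2`, the disk of radius
`‖s‖` about any `t * s` lies in the unit disk, so `ζ ↦ f (t * s + s * ζ)` shows that the velocity
has Kobayashi norm at most 1. -/
theorem DiscLinked.kobayashiDist_le_one [CompleteSpace E] {Ω : Set E} {p q : E}
    (h : DiscLinked Ω p q) : kobayashiDist Ω p q ≤ 1 := by
  obtain ⟨f, hf, hm, h0, s, hs, h1⟩ := h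
  have hball : ∀ t ∈ Icc (0 : ℝ) 1, (t : ℂ) * s ∈ Metric.ball (0 : ℂ) 1 := by
    intro t ht
    rw [mem_ball_zero_iff, norm_mul, Complex.norm_real, Real.norm_of_nonneg ht.1]
    nlinarith [ht.2, norm_nonneg s]
  have hsmooth : ContDiffOn ℝ ∞ (fun t : ℝ => f (t * s)) (Icc 0 1) := by
    have h1 : ContDiffOn ℝ ∞ f (Metric.ball 0 1) :=
      (hf.contDiffOn (n := ∞) Metric.isOpen_ball).restrict_scalars ℝ
    exact h1.comp ((Complex.ofRealCLM.contDiff.mul contDiff_const).contDiffOn) hball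
  have hder : ∀ t ∈ Icc (0 : ℝ) 1,
      HasDerivAt (fun t : ℝ => f (t * s)) (s • deriv f (t * s)) t := by
    intro t ht
    have h1 : HasDerivAt f (deriv f (t * s)) ((t : ℂ) * s) :=
      (hf.differentiableAt (Metric.isOpen_ball.mem_nhds (hball t ht))).hasDerivAt
    have h2 : HasDerivAt (fun t : ℝ => (t : ℂ) * s) s t := by
      simpa using (Complex.ofRealCLM.hasDerivAt (x := t)).mul_const s
    exact h1.scomp t h2
  have hK : ∀ t ∈ Icc (0 : ℝ) 1,
      kobayashiMetric Ω (f (t * s)) (deriv (fun t : ℝ => f (t * s)) t) ≤ 1 := by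
    intro t ht
    have hmaps : MapsTo (fun ζ : ℂ => t * s + s * ζ) (Metric.ball 0 1) (Metric.ball 0 1) := by
      intro ζ hζ
      rw [mem_ball_zero_iff] at hζ ⊢
      rcases eq_or_ne s 0 with rfl | hs0
      · simp
      have hpos : 0 < ‖s‖ := norm_pos_iff.2 hs0
      calc ‖(t : ℂ) * s + s * ζ‖ ≤ t * ‖s‖ + ‖s‖ * ‖ζ‖ := by
            refine (norm_add_le _ _).trans_eq ?_
            rw [norm_mul, norm_mul, Complex.norm_real, Real.norm_of_nonneg ht.1]
        _ < 1 := by nlinarith [ht.2, mul_lt_mul_of_pos_left hζ hpos]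
    have hinner : ∀ ζ : ℂ, HasDerivAt (fun ζ : ℂ => t * s + s * ζ) s ζ := fun ζ => by
      simpa using ((hasDerivAt_id ζ).const_mul s).const_add ((t : ℂ) * s)
    have := kobayashiMetric_le_of_disc (Ω := Ω) (z := f (t * s)) (ξ := s • deriv f (t * s))
      one_pos (f := fun ζ => f (t * s + s * ζ))
      (hf.comp (fun ζ _ => (hinner ζ).differentiableAt.differentiableWithinAt) hmaps)
      (hm.comp hmaps) (by simp) ?_
    · rw [(hder t ht).deriv]
      simpa using this
    · have h1 : HasDerivAt f (deriv f (t * s)) (t * s + s * 0) := by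
        simpa using
          (hf.differentiableAt (Metric.isOpen_ball.mem_nhds (hball t ht))).hasDerivAt
      have h2 := h1.scomp (0 : ℂ) (hinner 0)
      have h3 : deriv (fun ζ : ℂ => f (t * s + s * ζ)) 0 = s • deriv f (t * s) := h2.deriv
      rw [h3]
      simp
  have hpw : IsPiecewiseSmooth (fun t : ℝ => f (t * s)) := by
    refine ⟨hsmooth.continuousOn, 1, fun i => (i : ℝ), ?_, by simp, by simp, ?_⟩
    · intro i j hij
      simpa using hij
    · intro i
      fin_cases i
      simpa using hsmooth
  calc kobayashiDist Ω p q ≤ kobayashiLength Ω (fun t : ℝ => f (t * s)) :=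
        sInf_le ⟨_, hpw, fun t ht => hm (hball t ht), by simpa using h0, by simpa using h1, rfl⟩
    _ ≤ ∫⁻ _ in Icc (0 : ℝ) 1, 1 := MeasureTheory.setLIntegral_mono' measurableSet_Icc hK
    _ = 1 := by simp

theorem DiscChain.kobayashiDist_le [CompleteSpace E] {Ω : Set E} {n : ℕ} {p q : E}
    (h : DiscChain Ω n p q) (hp : p ∈ Ω) : kobayashiDist Ω p q ≤ (n + 1 : ℕ) := by
  induction h with
  -- The trivial chain is charged 1 for a constant disk, whence the `+ 1` in the bound.
  | nil p => simpa using (DiscLinked.refl hp).kobayashiDist_le_one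
  | @cons n p q r hl _ ih =>
    calc kobayashiDist Ω p r ≤ kobayashiDist Ω p q + kobayashiDist Ω q r :=
          kobayashiDist_triangle Ω p q r
      _ ≤ 1 + (n + 1 : ℕ) := add_le_add hl.kobayashiDist_le_one (ih hl.mem_right)
      _ = (n + 1 + 1 : ℕ) := by
          push_cast
          ring

end Kobayashi

/-! ### Planar domains: removing countable sets, chains of bounded length. -/

/-- A homeomorphism of the plane onto the ball reduces this to the complement of a countable set in
the plane. -/
theorem isPreconnected_ball_diff_countable (c : ℂ) {r : ℝ} (hr : 0 < r) {S : Set ℂ}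
    (hS : S.Countable) : IsPreconnected (Metric.ball c r \ S) := by
  set e := OpenPartialHomeomorph.univBall c r with he
  have hinj : Function.Injective e := by
    have := e.injOn
    rwa [he, OpenPartialHomeomorph.univBall_source, injOn_univ] at this
  have himage : e '' univ = Metric.ball c r := by
    have := e.image_source_eq_target
    rwa [he, OpenPartialHomeomorph.univBall_source,
      OpenPartialHomeomorph.univBall_target c hr] at this
  have hpre : IsPreconnected (e ⁻¹' S)ᶜ :=
    ((hS.preimage hinj).isConnected_compl_of_one_lt_rank (by simp)).isPreconnected
  have := hpre.image e (OpenPartialHomeomorph.continuous_univBall c r).continuousOn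
  rwa [compl_eq_univ_sdiff, image_sdiff hinj, himage, image_preimage_eq_inter_range,
    ← image_univ, himage, sdiff_inter, sdiff_self, union_empty] at this

/-- A countable set does not disconnect a planar domain. -/
theorem IsPreconnected.diff_countable {Ω S : Set ℂ} (hΩ : IsPreconnected Ω) (hΩo : IsOpen Ω)
    (hS : S.Countable) : IsPreconnected (Ω \ S) := by
  rcases (Ω \ S).eq_empty_or_nonempty with h | ⟨a, ha⟩
  · rw [h]
    exact isPreconnected_empty
  have hloc : ∀ x ∈ Ω, ∃ ε > 0, Metric.ball x ε ⊆ Ω := Metric.isOpen_iff.1 hΩo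
  -- `U` may contain points of `S`: only the points off `S` near `x` must be connected to `a`. It is
  -- open and relatively closed in `Ω`.
  set U : Set ℂ := {x | ∃ ε > 0, ∀ y ∈ Metric.ball x ε \ S, ∃ t ⊆ Ω \ S, a ∈ t ∧ y ∈ t ∧
    IsPreconnected t} with hU
  have hUo : IsOpen U := by
    refine Metric.isOpen_iff.2 fun x hx => ?_
    obtain ⟨ε, hε, h⟩ := hx
    refine ⟨ε, hε, fun y hy => ⟨ε - dist y x, sub_pos.2 hy, fun z hz => h z ⟨?_, hz.2⟩⟩⟩
    exact Metric.ball_subset_ball' (by linarith) hz.1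
  have haU : a ∈ U := by
    obtain ⟨ε, hε, h⟩ := hloc a ha.1
    exact ⟨ε, hε, fun y hy => ⟨_, sdiff_subset_sdiff_left h, ⟨Metric.mem_ball_self hε, ha.2⟩, hy,
      isPreconnected_ball_diff_countable a hε hS⟩⟩
  have hsub : Ω ⊆ U := by
    refine hΩ.subset_of_closure_inter_subset hUo ⟨a, ha.1, haU⟩ ?_
    rintro x ⟨hxU, hxΩ⟩
    obtain ⟨ε, hε, h⟩ := hloc x hxΩ
    obtain ⟨y, hyU, hy⟩ := Metric.mem_closure_iff.1 hxU ε hε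
    obtain ⟨δ, hδ, hyδ⟩ := hyU
    obtain ⟨p, ⟨hp1, hp2⟩, hpS⟩ := (hS.dense_compl ℝ).inter_open_nonempty
      (Metric.ball y δ ∩ Metric.ball x ε) (Metric.isOpen_ball.inter Metric.isOpen_ball)
      ⟨y, Metric.mem_ball_self hδ, by rwa [Metric.mem_ball, dist_comm]⟩
    obtain ⟨t, htΩ, hat, hpt, htc⟩ := hyδ p ⟨hp1, hpS⟩
    exact ⟨ε, hε, fun z hz => ⟨t ∪ (Metric.ball x ε \ S),
      union_subset htΩ (sdiff_subset_sdiff_left h), Or.inl hat, Or.inr hz,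
      htc.union p hpt ⟨hp2, hpS⟩ (isPreconnected_ball_diff_countable x hε hS)⟩⟩
  refine isPreconnected_of_forall a fun y hy => ?_
  obtain ⟨ε, hε, h⟩ := hsub hy.1
  obtain ⟨t, ht, h⟩ := h y ⟨Metric.mem_ball_self hε, hy.2⟩
  exact ⟨t, ht, h.1, h.2.1, h.2.2⟩

theorem discLinked_of_ball_subset {W : Set ℂ} {x y : ℂ} {ε : ℝ} (hε : 0 < ε)
    (hW : Metric.ball x ε ⊆ W) (hxy : dist y x ≤ ε / 2) : DiscLinked W x y := by
  have hε' : (ε : ℂ) ≠ 0 := by exact_mod_cast hε.ne'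
  refine ⟨fun ζ => x + ε * ζ, by fun_prop, fun ζ hζ => hW ?_, by simp, (y - x) / ε, ?_, ?_⟩
  · rw [mem_ball_zero_iff] at hζ
    rw [mem_ball_iff_norm, add_sub_cancel_left, norm_mul, Complex.norm_real,
      Real.norm_of_nonneg hε.le]
    nlinarith
  · rw [norm_div, Complex.norm_real, Real.norm_of_nonneg hε.le, div_le_iff₀ hε, ← dist_eq_norm]
    linarith
  · simp only
    rw [mul_div_cancel₀ _ hε']
    ring

/-- `DiscLinked` is not symmetric; in `exists_discChain` one direction gives openness and the other
closedness. -/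
theorem exists_ball_discLinked {W : Set ℂ} (hW : IsOpen W) {x : ℂ} (hx : x ∈ W) :
    ∃ ε > 0, ∀ y ∈ Metric.ball x ε, DiscLinked W x y ∧ DiscLinked W y x := by
  obtain ⟨ε, hε, h⟩ := Metric.isOpen_iff.1 hW x hx
  refine ⟨ε / 4, by linarith, fun y hy => ?_⟩
  rw [Metric.mem_ball] at hy
  refine ⟨discLinked_of_ball_subset hε h (by linarith),
    discLinked_of_ball_subset (ε := ε / 2) (by linarith) (fun z hz => h ?_) ?_⟩
  · rw [Metric.mem_ball] at hz ⊢
    linarith [dist_triangle z y x]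
  · rw [dist_comm]
    linarith

theorem exists_discChain {W : Set ℂ} (hW : IsOpen W) (hWc : IsPreconnected W) {a : ℂ}
    (ha : a ∈ W) : ∀ x ∈ W, ∃ n, DiscChain W n x a := by
  set U : Set ℂ := {x | x ∈ W ∧ ∃ n, DiscChain W n x a} with hU
  have hUo : IsOpen U := by
    refine Metric.isOpen_iff.2 fun x hx => ?_
    obtain ⟨hxW, n, hn⟩ := hx
    obtain ⟨ε, hε, h⟩ := exists_ball_discLinked hW hxW
    exact ⟨ε, hε, fun y hy => ⟨(h y hy).1.mem_right, n + 1, .cons (h y hy).2 hn⟩⟩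
  have hsub : W ⊆ U := by
    refine hWc.subset_of_closure_inter_subset hUo ⟨a, ha, ha, 0, .nil a⟩ ?_
    rintro x ⟨hxU, hxW⟩
    obtain ⟨ε, hε, h⟩ := exists_ball_discLinked hW hxW
    obtain ⟨y, ⟨_, n, hn⟩, hy⟩ := Metric.mem_closure_iff.1 hxU ε hε
    exact ⟨hxW, n + 1, .cons (h y (by rwa [Metric.mem_ball, dist_comm])).1 hn⟩
  exact fun x hx => (hsub hx).2

/-- In a planar domain, chains of disks from the points of a compact set to a given point can be
chosen of uniformly bounded length. -/
theorem IsCompact.exists_discChain {W R : Set ℂ} (hR : IsCompact R) (hRW : R ⊆ W)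
    (hW : IsOpen W) (hWc : IsPreconnected W) {a : ℂ} (ha : a ∈ W) :
    ∃ N, ∀ x ∈ R, DiscChain W N x a := by
  refine hR.induction_on (p := fun s => ∃ N, ∀ x ∈ s, x ∈ W → DiscChain W N x a)
    ⟨0, by simp⟩ (fun s t hst ⟨N, h⟩ => ⟨N, fun x hx => h x (hst hx)⟩) ?_ ?_ |>.imp
      fun N h x hx => h x hx (hRW hx)
  · rintro s t ⟨N, hN⟩ ⟨M, hM⟩
    refine ⟨max N M, fun x hx hxW => ?_⟩
    rcases hx with hx | hx
    · exact (hN x hx hxW).mono hxW (le_max_left _ _)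
    · exact (hM x hx hxW).mono hxW (le_max_right _ _)
  · intro x hx
    obtain ⟨ε, hε, h⟩ := exists_ball_discLinked hW (hRW hx)
    obtain ⟨n, hn⟩ := _root_.exists_discChain hW hWc ha x (hRW hx)
    exact ⟨_, mem_nhdsWithin_of_mem_nhds (Metric.ball_mem_nhds x hε), n + 1,
      fun y hy _ => .cons (h y hy).2 hn⟩

/-! ### Lifting disks through polynomials. -/

/-- A holomorphic disk avoiding the critical values of a polynomial lifts through it. -/
theorem Polynomial.exists_disc_lift (q : Polynomial ℂ) {f : ℂ → ℂ}
    (hf : DifferentiableOn ℂ f (Metric.ball 0 1))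
    (hcrit : ∀ y, q.eval y ∈ f '' Metric.ball 0 1 → q.derivative.eval y ≠ 0)
    {y₀ : ℂ} (hy₀ : q.eval y₀ = f 0) :
    ∃ F : ℂ → ℂ, DifferentiableOn ℂ F (Metric.ball 0 1) ∧ F 0 = y₀ ∧
      ∀ ζ ∈ Metric.ball (0 : ℂ) 1, q.eval (F ζ) = f ζ := by
  have : ContractibleSpace (Metric.ball (0 : ℂ) 1) := Metric.contractibleSpace_ball one_pos
  have : LocallyPathConnectedSpace (Metric.ball (0 : ℂ) 1) :=
    Metric.isOpen_ball.locallyPathConnectedSpace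
  let a₀ : Metric.ball (0 : ℂ) 1 := ⟨0, by simp⟩
  let φ : C(Metric.ball (0 : ℂ) 1, ℂ) := ⟨fun ζ => f ζ, hf.continuousOn.domRestrict⟩
  -- The polynomial is a covering away from its critical values and the disk is contractible, so a
  -- continuous lift exists.
  obtain ⟨F, ⟨hF0, hF⟩, -⟩ := q.isCoveringMapOn_eval.existsUnique_continuousMap_lifts φ
    (a₀ := a₀) (e₀ := y₀) hy₀ (by
      rintro ζ ⟨y, hy, hyζ⟩
      exact hcrit y ⟨ζ, ζ.2, hyζ.symm⟩ hy)
  classical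
  let G : ℂ → ℂ := fun ζ => if h : ζ ∈ Metric.ball (0 : ℂ) 1 then F ⟨ζ, h⟩ else 0
  have hG : ∀ ζ (h : ζ ∈ Metric.ball (0 : ℂ) 1), G ζ = F ⟨ζ, h⟩ := fun ζ h => dif_pos h
  have hqG : ∀ ζ ∈ Metric.ball (0 : ℂ) 1, q.eval (G ζ) = f ζ := fun ζ h => by
    rw [hG ζ h]
    exact congrFun hF ⟨ζ, h⟩
  have hGc : ContinuousOn G (Metric.ball 0 1) := by
    rw [continuousOn_iff_continuous_domRestrict]
    convert F.continuous using 1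
    ext ζ
    exact hG ζ ζ.2
  refine ⟨G, fun ζ hζ => ?_, (hG 0 (by simp)).trans hF0, hqG⟩
  have hnhds : Metric.ball (0 : ℂ) 1 ∈ 𝓝 ζ := Metric.isOpen_ball.mem_nhds hζ
  have hne : q.derivative.eval (G ζ) ≠ 0 := hcrit _ (hqG ζ hζ ▸ mem_image_of_mem f hζ)
  have hloc := (q.hasStrictDerivAt (G ζ)).to_localInverse hne
  set g := (q.hasStrictDerivAt (G ζ)).localInverse _ _ _ hne with hg
  have hleft : ∀ᶠ y in 𝓝 (G ζ), g (q.eval y) = y :=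
    ((q.hasStrictDerivAt (G ζ)).hasStrictFDerivAt_equiv hne).eventually_left_inverse
  -- Locally the continuous lift is a holomorphic inverse branch composed with `f`.
  have hev : G =ᶠ[𝓝 ζ] fun ξ => g (f ξ) := by
    filter_upwards [(hGc.continuousAt hnhds).eventually hleft, hnhds] with ξ h1 h2
    rw [← hqG ξ h2, h1]
  refine DifferentiableAt.differentiableWithinAt (DifferentiableAt.congr_of_eventuallyEq ?_ hev)
  refine DifferentiableAt.comp (g := g) ζ ?_ (hf.differentiableAt hnhds)
  rw [← hqG ζ hζ]
  exact hloc.hasDerivAt.differentiableAt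

/-! ### Basins of attraction in topological spaces. -/

section Basin

variable {X : Type*} [TopologicalSpace X] {F : X → X} {p : X}

theorem iterate_mem_attractingBasin {n : ℕ} {x : X} :
    F^[n] x ∈ attractingBasin F p ↔ x ∈ attractingBasin F p := by
  simp only [attractingBasin, mem_ofPred_eq, ← Function.iterate_add_apply]
  exact tendsto_add_atTop_iff_nat (f := fun k => F^[k] x) n

theorem mem_attractingBasin_self (hp : F p = p) : p ∈ attractingBasin F p := by
  simp only [attractingBasin, mem_ofPred_eq, Function.iterate_fixed hp]
  exact tendsto_const_nhds

theorem immediateBasin_subset : immediateBasin F p ⊆ attractingBasin F p :=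
  connectedComponentIn_subset _ _

theorem isPreconnected_immediateBasin : IsPreconnected (immediateBasin F p) :=
  isPreconnected_connectedComponentIn

theorem mem_immediateBasin_self (hp : F p = p) : p ∈ immediateBasin F p :=
  mem_connectedComponentIn (mem_attractingBasin_self hp)

theorem IsPreconnected.subset_immediateBasin {T : Set X} (hT : IsPreconnected T)
    (hTB : T ⊆ attractingBasin F p) (hne : (T ∩ immediateBasin F p).Nonempty) :
    T ⊆ immediateBasin F p := by
  obtain ⟨y, hyT, hy⟩ := hne
  rw [immediateBasin, connectedComponentIn_eq hy]
  exact hT.subset_connectedComponentIn hyT hTB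

theorem mapsTo_immediateBasin (hF : Continuous F) (hp : F p = p) :
    MapsTo F (immediateBasin F p) (immediateBasin F p) := by
  rw [mapsTo_iff_image_subset]
  refine (isPreconnected_immediateBasin.image F hF.continuousOn).subset_immediateBasin ?_
    ⟨p, ⟨p, mem_immediateBasin_self hp, hp⟩, mem_immediateBasin_self hp⟩
  rintro _ ⟨x, hx, rfl⟩
  exact (iterate_mem_attractingBasin (n := 1)).2 (immediateBasin_subset hx)

theorem iterate_mem_immediateBasin (hF : Continuous F) (hp : F p = p) (n : ℕ) {x : X}
    (hx : x ∈ immediateBasin F p) : F^[n] x ∈ immediateBasin F p :=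
  (mapsTo_immediateBasin hF hp).iterate n hx

/-- Adding limit points to a connected set keeps it connected, so a component is relatively closed
in the basin. -/
theorem closure_immediateBasin_inter_subset (hp : F p = p) :
    closure (immediateBasin F p) ∩ attractingBasin F p ⊆ immediateBasin F p := by
  refine IsPreconnected.subset_immediateBasin
    (isPreconnected_immediateBasin.subset_closure
      (subset_inter subset_closure immediateBasin_subset) inter_subset_left) inter_subset_right
    ⟨p, ⟨subset_closure (mem_immediateBasin_self hp), mem_attractingBasin_self hp⟩,
      mem_immediateBasin_self hp⟩

theorem IsCompact.inter_immediateBasin [T2Space X] (hp : F p = p) {K : Set X} (hK : IsCompact K)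
    (hKB : K ⊆ attractingBasin F p) : IsCompact (K ∩ immediateBasin F p) := by
  have : K ∩ immediateBasin F p = K ∩ closure (immediateBasin F p) :=
    Subset.antisymm (inter_subset_inter_right _ subset_closure)
      fun x hx => ⟨hx.1, closure_immediateBasin_inter_subset hp ⟨hx.2, hKB hx.1⟩⟩
  rw [this]
  exact hK.inter_right isClosed_closure

end Basin

/-! ### Trapping disks. -/

/-- `f` contracts the closed disk of radius `r` linearly towards `0`, and has there no zero other
than `0`. -/
structure IsTrappingRadius (f : ℂ → ℂ) (r : ℝ) : Prop where
  pos : 0 < r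
  contracts : ∃ κ : ℝ, 0 ≤ κ ∧ κ < 1 ∧ ∀ z, ‖z‖ ≤ r → ‖f z‖ ≤ κ * ‖z‖
  eq_zero : ∀ z, ‖z‖ ≤ r → f z = 0 → z = 0

namespace IsTrappingRadius

variable {f : ℂ → ℂ} {r : ℝ}

theorem norm_le (h : IsTrappingRadius f r) {z : ℂ} (hz : ‖z‖ ≤ r) : ‖f z‖ ≤ ‖z‖ := by
  obtain ⟨κ, _, hκ, hf⟩ := h.contracts
  nlinarith [hf z hz, norm_nonneg z]

theorem norm_iterate_le (h : IsTrappingRadius f r) {z : ℂ} (hz : ‖z‖ ≤ r) (n : ℕ) :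
    ‖f^[n] z‖ ≤ ‖z‖ := by
  induction n with
  | zero => rfl
  | succ n ih =>
    rw [Function.iterate_succ_apply']
    exact (h.norm_le (ih.trans hz)).trans ih

theorem norm_iterate_lt_of_le (h : IsTrappingRadius f r) {z : ℂ} {n m : ℕ} (hnm : n ≤ m)
    (hz : ‖f^[n] z‖ < r) : ‖f^[m] z‖ < r := by
  obtain ⟨k, rfl⟩ := Nat.exists_eq_add_of_le hnm
  rw [add_comm, Function.iterate_add_apply]
  exact (h.norm_iterate_le hz.le k).trans_lt hz

theorem mem_basin_of_norm_le (h : IsTrappingRadius f r) {z : ℂ} (hz : ‖z‖ ≤ r) :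
    z ∈ attractingBasin f 0 := by
  obtain ⟨κ, hκ0, hκ, hf⟩ := h.contracts
  have hbound : ∀ n, ‖f^[n] z‖ ≤ κ ^ n * ‖z‖ := by
    intro n
    induction n with
    | zero => simp
    | succ n ih =>
      rw [Function.iterate_succ_apply', pow_succ', mul_assoc]
      exact (hf _ ((h.norm_iterate_le hz n).trans hz)).trans (mul_le_mul_of_nonneg_left ih hκ0)
  refine squeeze_zero_norm hbound ?_
  simpa using (tendsto_pow_atTop_nhds_zero_of_lt_one hκ0 hκ).mul_const ‖z‖

theorem mem_basin_of_norm_iterate_le (h : IsTrappingRadius f r) {z : ℂ} {n : ℕ}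
    (hz : ‖f^[n] z‖ ≤ r) : z ∈ attractingBasin f 0 :=
  iterate_mem_attractingBasin.1 (h.mem_basin_of_norm_le hz)

theorem exists_norm_iterate_lt (h : IsTrappingRadius f r) {z : ℂ}
    (hz : z ∈ attractingBasin f 0) : ∃ n, ‖f^[n] z‖ < r := by
  have hz' : Tendsto (fun n => f^[n] z) atTop (𝓝 0) := hz
  obtain ⟨n, hn⟩ := (hz'.eventually (Metric.ball_mem_nhds 0 h.pos)).exists
  exact ⟨n, mem_ball_zero_iff.1 hn⟩

theorem isOpen_basin (h : IsTrappingRadius f r) (hf : Continuous f) :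
    IsOpen (attractingBasin f 0) := by
  have : attractingBasin f 0 = ⋃ n : ℕ, {z | ‖f^[n] z‖ < r} := by
    ext z
    rw [mem_iUnion]
    exact ⟨h.exists_norm_iterate_lt, fun ⟨n, hn⟩ => h.mem_basin_of_norm_iterate_le (le_of_lt hn)⟩
  rw [this]
  exact isOpen_iUnion fun n => isOpen_lt (hf.iterate n).norm continuous_const

theorem isOpen_immediateBasin (h : IsTrappingRadius f r) (hf : Continuous f) :
    IsOpen (immediateBasin f 0) :=
  (h.isOpen_basin hf).connectedComponentIn

end IsTrappingRadius

/-! ### Polynomial dynamics near an attracting fixed point. -/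

namespace Polynomial

variable {P : Polynomial ℂ}

theorem eval_eq_mul_divX (h0 : P.eval 0 = 0) (z : ℂ) : P.eval z = z * P.divX.eval z := by
  have hc : P.coeff 0 = 0 := by rwa [coeff_zero_eq_eval_zero]
  conv_lhs => rw [← P.divX_mul_X_add, hc]
  simp [mul_comm]

theorem eval_zero_divX : P.divX.eval 0 = P.derivative.eval 0 := by
  rw [← coeff_zero_eq_eval_zero, ← coeff_zero_eq_eval_zero, coeff_divX, coeff_derivative]
  simp

/-- Near `0` the modulus of `P(z) / z` is close to that of `P'(0)`: being below `κ < 1` gives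
contraction, being positive excludes other zeros. -/
theorem exists_isTrappingRadius (h0 : P.eval 0 = 0) (hpos : 0 < ‖P.derivative.eval 0‖)
    (hlt : ‖P.derivative.eval 0‖ < 1) : ∃ r, IsTrappingRadius (fun z => P.eval z) r := by
  obtain ⟨κ, hκ, hκ1⟩ := exists_between hlt
  have hev : ∀ᶠ z in 𝓝 (0 : ℂ), 0 < ‖P.divX.eval z‖ ∧ ‖P.divX.eval z‖ < κ := by
    have hc : ContinuousAt (fun z => ‖P.divX.eval z‖) 0 := P.divX.continuous.norm.continuousAt
    refine (hc.eventually_const_lt ?_).and (hc.eventually_lt_const ?_) <;>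
      simpa only [eval_zero_divX]
  obtain ⟨r, hr, h⟩ := Metric.nhds_basis_closedBall.eventually_iff.1 hev
  refine ⟨r, hr, ⟨κ, (norm_nonneg _).trans hκ.le, hκ1, fun z hz => ?_⟩, fun z hz hz0 => ?_⟩
  · rw [eval_eq_mul_divX h0, norm_mul, mul_comm]
    exact mul_le_mul_of_nonneg_right (h (mem_closedBall_zero_iff.2 hz)).2.le (norm_nonneg z)
  · rw [eval_eq_mul_divX h0] at hz0
    exact (mul_eq_zero.1 hz0).resolve_right (norm_pos_iff.1 (h (mem_closedBall_zero_iff.2 hz)).1)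

theorem eval_iterate_comp_X (P : Polynomial ℂ) (n : ℕ) (z : ℂ) :
    (P.comp^[n] X).eval z = (fun x => P.eval x)^[n] z := by
  simp [iterate_comp_eval]

theorem derivative_iterate_comp_X_succ_eval (P : Polynomial ℂ) (n : ℕ) (z : ℂ) :
    (P.comp^[n + 1] X).derivative.eval z =
      P.derivative.eval ((fun x => P.eval x)^[n] z) * (P.comp^[n] X).derivative.eval z := by
  rw [Function.iterate_succ_apply', derivative_comp, eval_mul, eval_comp, eval_iterate_comp_X,
    mul_comm]

theorem derivative_iterate_comp_X_eval_zero (h0 : P.eval 0 = 0) (n : ℕ) :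
    (P.comp^[n] X).derivative.eval 0 = P.derivative.eval 0 ^ n := by
  induction n with
  | zero => simp
  | succ n ih =>
    rw [derivative_iterate_comp_X_succ_eval, ih,
      Function.iterate_fixed (f := fun x => P.eval x) h0, pow_succ']

theorem exists_eq_zero_of_derivative_iterate_eq_zero {n : ℕ} {z : ℂ}
    (h : (P.comp^[n] X).derivative.eval z = 0) :
    ∃ k < n, P.derivative.eval ((fun x => P.eval x)^[k] z) = 0 := by
  induction n with
  | zero => simp at h
  | succ n ih =>
    rw [derivative_iterate_comp_X_succ_eval, mul_eq_zero] at h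
    rcases h with h | h
    · exact ⟨n, n.lt_succ_self, h⟩
    · obtain ⟨k, hk, h⟩ := ih h
      exact ⟨k, hk.trans n.lt_succ_self, h⟩

theorem degree_iterate_comp_X_pos (hdeg : 2 ≤ P.natDegree) (n : ℕ) :
    0 < (P.comp^[n] X).degree := by
  rw [← natDegree_pos_iff_degree_pos, natDegree_iterate_comp, natDegree_X, mul_one]
  positivity

theorem isOpenMap_eval_of_natDegree_pos (hdeg : 0 < P.natDegree) :
    IsOpenMap (fun z => P.eval z) := by
  refine (AnalyticOnNhd.is_constant_or_isOpenMap (g := fun z => P.eval z) ?_).resolve_left ?_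
  · exact (P.differentiable.differentiableOn).analyticOnNhd isOpen_univ
  · rintro ⟨w, hw⟩
    have : P = C w := Polynomial.funext fun z => by rw [hw z, eval_C]
    rw [this, natDegree_C] at hdeg
    exact lt_irrefl _ hdeg

theorem isCompact_iterate_preimage_closedBall (hdeg : 2 ≤ P.natDegree) (n : ℕ) (r : ℝ) :
    IsCompact {z : ℂ | ‖(fun x => P.eval x)^[n] z‖ ≤ r} := by
  have := ((P.comp^[n] X).isProperMap_eval (degree_iterate_comp_X_pos hdeg n)).isCompact_preimage
    (isCompact_closedBall (0 : ℂ) r)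
  convert this using 1
  ext z
  simp only [mem_ofPred_eq, mem_preimage, mem_closedBall_zero_iff, eval_iterate_comp_X]

/-- For large `z` the quotient `P(z) / z` has modulus at least 1, so norms cannot decrease along the
orbit. -/
theorem exists_norm_le_of_mem_basin (hdeg : 2 ≤ P.natDegree) (h0 : P.eval 0 = 0) :
    ∃ D : ℝ, ∀ z ∈ attractingBasin (fun z => P.eval z) 0, ‖z‖ ≤ D := by
  have hd : 0 < P.divX.degree := by
    rw [← natDegree_pos_iff_degree_pos, natDegree_divX_eq_natDegree_tsub_one]
    omega
  have htend := P.divX.tendsto_norm_atTop hd (tendsto_norm_cobounded_atTop (E := ℂ))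
  obtain ⟨D, hD⟩ := (Filter.hasBasis_cobounded_norm (E := ℂ)).eventually_iff.1
    (htend.eventually_ge_atTop 1)
  refine ⟨max D 1, fun z hz => ?_⟩
  by_contra! hlt
  have hgrow : ∀ n, ‖z‖ ≤ ‖(fun z => P.eval z)^[n] z‖ := by
    intro n
    induction n with
    | zero => rfl
    | succ n ih =>
      rw [Function.iterate_succ_apply']
      refine ih.trans ?_
      have h1 := hD.2 (show _ ∈ {x : ℂ | D ≤ ‖x‖} from
        ((le_max_left D 1).trans hlt.le).trans ih)
      rw [eval_eq_mul_divX h0, norm_mul]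
      exact le_mul_of_one_le_right (norm_nonneg _) h1
  have hz' : Tendsto (fun n => (fun z => P.eval z)^[n] z) atTop (𝓝 0) := hz
  have hle := ge_of_tendsto' hz'.norm hgrow
  rw [norm_zero] at hle
  linarith [le_max_right D 1]

/-- The image is open by the open mapping theorem and relatively closed by properness, while the
immediate basin is connected. -/
theorem immediateBasin_subset_image (hdeg : 2 ≤ P.natDegree) (h0 : P.eval 0 = 0) {r : ℝ}
    (hr : IsTrappingRadius (fun z => P.eval z) r) :
    immediateBasin (fun z => P.eval z) 0 ⊆
      (fun z => P.eval z) '' immediateBasin (fun z => P.eval z) 0 := by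
  set f : ℂ → ℂ := fun z => P.eval z with hf
  have hfc : Continuous f := P.continuous
  have hΩo := hr.isOpen_immediateBasin hfc
  have h0Ω : (0 : ℂ) ∈ immediateBasin f 0 := mem_immediateBasin_self h0
  refine isPreconnected_immediateBasin.subset_of_closure_inter_subset
    (isOpenMap_eval_of_natDegree_pos (by omega) _ hΩo) ⟨0, h0Ω, 0, h0Ω, h0⟩ ?_
  rintro w ⟨hwc, hw⟩
  by_contra hnot
  obtain ⟨ε, hε, hball⟩ := Metric.nhds_basis_closedBall.mem_iff.1 (hΩo.mem_nhds hw)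
  have hK : IsCompact (f ⁻¹' Metric.closedBall w ε) :=
    (P.isProperMap_eval (natDegree_pos_iff_degree_pos.1 (by omega))).isCompact_preimage
      (isCompact_closedBall w ε)
  have hKΩ : IsCompact (f ⁻¹' Metric.closedBall w ε ∩ immediateBasin f 0) :=
    hK.inter_immediateBasin h0 fun z hz =>
      (iterate_mem_attractingBasin (n := 1)).1 (immediateBasin_subset (hball hz))
  have hclosed := (hKΩ.image hfc).isClosed
  have hmem : (f '' (f ⁻¹' Metric.closedBall w ε ∩ immediateBasin f 0))ᶜ ∩
      Metric.closedBall w ε ∈ 𝓝 w :=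
    inter_mem (hclosed.isOpen_compl.mem_nhds fun h => hnot (image_mono inter_subset_right h))
      (Metric.closedBall_mem_nhds w hε)
  obtain ⟨_, ⟨h1, h2⟩, z, hz, rfl⟩ := mem_closure_iff_nhds.1 hwc _ hmem
  exact h1 ⟨z, ⟨h2, hz⟩, rfl⟩

theorem exists_iterate_eq_of_mem_immediateBasin (hdeg : 2 ≤ P.natDegree) (h0 : P.eval 0 = 0)
    {r : ℝ} (hr : IsTrappingRadius (fun z => P.eval z) r) (n : ℕ) {w : ℂ}
    (hw : w ∈ immediateBasin (fun z => P.eval z) 0) :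
    ∃ z ∈ immediateBasin (fun z => P.eval z) 0, (fun z => P.eval z)^[n] z = w := by
  induction n generalizing w with
  | zero => exact ⟨w, hw, rfl⟩
  | succ n ih =>
    obtain ⟨v, hv, rfl⟩ := immediateBasin_subset_image hdeg h0 hr hw
    obtain ⟨z, hz, rfl⟩ := ih hv
    exact ⟨z, hz, Function.iterate_succ_apply' _ _ _⟩

/-- The immediate basin contains a preimage of the attracting fixed point other than itself. -/
theorem exists_ne_zero_eval_eq_zero (hdeg : 2 ≤ P.natDegree) (h0 : P.eval 0 = 0)
    (hpos : 0 < ‖P.derivative.eval 0‖) (hlt : ‖P.derivative.eval 0‖ < 1) {r : ℝ}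
    (hr : IsTrappingRadius (fun z => P.eval z) r) :
    ∃ b ∈ immediateBasin (fun z => P.eval z) 0, b ≠ 0 ∧ P.eval b = 0 := by
  by_contra! hno
  set f : ℂ → ℂ := fun z => P.eval z with hf
  have hfc : Continuous f := P.continuous
  have hΩo := hr.isOpen_immediateBasin hfc
  have h0Ω : (0 : ℂ) ∈ immediateBasin f 0 := mem_immediateBasin_self h0
  obtain ⟨D, hD⟩ := exists_norm_le_of_mem_basin hdeg h0
  have hzero : ∀ m : ℕ, ∀ z ∈ immediateBasin f 0, f^[m] z = 0 → z = 0 := by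
    intro m
    induction m with
    | zero => exact fun z _ h => h
    | succ m ih =>
      intro z hz h
      have h1 := ih (f z) (mapsTo_immediateBasin hfc h0 hz) h
      by_contra hne
      exact hno z hz hne h1
  -- With `f^m z = z * q z`, the function `1 / q` is holomorphic on `Ω`, is at most `D / r` where
  -- `‖f^m z‖ = r`, and equals `P'(0)^(-m)` at `0`.
  have hbound : ∀ m : ℕ, (‖P.derivative.eval 0‖⁻¹) ^ m ≤ D / r := by
    intro m
    set q := (P.comp^[m] X).divX with hq
    have hfq : ∀ z, f^[m] z = z * q.eval z := fun z => by
      rw [hq, ← eval_eq_mul_divX, eval_iterate_comp_X]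
      rw [eval_iterate_comp_X, Function.iterate_fixed (f := fun x => P.eval x) h0]
    have hq0 : q.eval 0 = P.derivative.eval 0 ^ m := by
      rw [hq, eval_zero_divX, derivative_iterate_comp_X_eval_zero h0]
    have hqne : ∀ z ∈ immediateBasin f 0, q.eval z ≠ 0 := by
      intro z hz hqz
      have hz0 := hzero m z hz (by rw [hfq, hqz, mul_zero])
      rw [hz0, hq0] at hqz
      exact pow_ne_zero m (norm_pos_iff.1 hpos) hqz
    set U : Set ℂ := {z | ‖f^[m] z‖ < r} ∩ immediateBasin f 0 with hU
    have hUo : IsOpen U := (isOpen_lt (hfc.iterate m).norm continuous_const).inter hΩo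
    have hK : IsCompact ({z | ‖f^[m] z‖ ≤ r} ∩ immediateBasin f 0) :=
      (isCompact_iterate_preimage_closedBall hdeg m r).inter_immediateBasin h0
        fun z hz => hr.mem_basin_of_norm_iterate_le hz
    -- The closure of `U` does not leave `Ω`, so its frontier lies on `‖f^m z‖ = r`.
    have hUcl : closure U ⊆ {z | ‖f^[m] z‖ ≤ r} ∩ immediateBasin f 0 :=
      hK.isClosed.closure_subset_iff.2 fun z hz => ⟨(show ‖f^[m] z‖ < r from hz.1).le, hz.2⟩
    have hdiff : DiffContOnCl ℂ (fun z => (q.eval z)⁻¹) U :=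
      DifferentiableOn.diffContOnCl fun z hz =>
        (q.differentiableAt.inv (hqne z (hUcl hz).2)).differentiableWithinAt
    have hmax := Complex.norm_le_of_forall_mem_frontier_norm_le (C := D / r)
      (hK.isBounded.subset (subset_closure.trans hUcl)) hdiff ?_
      (subset_closure (show (0 : ℂ) ∈ U from ⟨?_, h0Ω⟩))
    · simpa [hq0] using hmax
    · intro z hz
      rw [frontier, hUo.interior_eq] at hz
      obtain ⟨hzr, hzΩ⟩ := hUcl hz.1
      have hzr' : ‖f^[m] z‖ = r := le_antisymm hzr (not_lt.1 fun h => hz.2 ⟨h, hzΩ⟩)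
      have hqpos : 0 < ‖q.eval z‖ := norm_pos_iff.2 (hqne z hzΩ)
      rw [hfq, norm_mul] at hzr'
      rw [norm_inv, inv_le_iff_one_le_mul₀ hqpos, div_mul_eq_mul_div, one_le_div hr.pos, ← hzr']
      exact mul_le_mul_of_nonneg_right (hD z (immediateBasin_subset hzΩ)) hqpos.le
    · simpa [Function.iterate_fixed (f := f) h0] using hr.pos
  obtain ⟨m, hm⟩ := pow_unbounded_of_one_lt (D / r) ((one_lt_inv₀ hpos).2 hlt)
  exact (hbound m).not_gt hm

/-! ### The postcritical set and lifting of chains. -/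

/-- The attracting fixed point `0` together with the forward orbits of the critical values whose
critical points are attracted to `0`. -/
def attractedPostcriticalSet (P : Polynomial ℂ) : Set ℂ :=
  insert 0 (⋃ c ∈ {c | P.derivative.eval c = 0 ∧ c ∈ attractingBasin (fun z => P.eval z) 0},
    insert 0 (range fun j : ℕ => (fun z => P.eval z)^[j + 1] c))

theorem finite_attracted_critical (hne : P.derivative ≠ 0) :
    {c | P.derivative.eval c = 0 ∧ c ∈ attractingBasin (fun z => P.eval z) 0}.Finite :=
  (Polynomial.finite_setOfPred_isRoot hne).subset fun _ hc => hc.1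

theorem isCompact_attractedPostcriticalSet (hne : P.derivative ≠ 0) :
    IsCompact (attractedPostcriticalSet P) := by
  refine ((finite_attracted_critical hne).isCompact_biUnion fun c hc => ?_).insert 0
  have hc' : Tendsto (fun n => (fun z => P.eval z)^[n] c) atTop (𝓝 0) := hc.2
  exact ((tendsto_add_atTop_iff_nat 1).2 hc').isCompact_insert_range

theorem countable_attractedPostcriticalSet (hne : P.derivative ≠ 0) :
    (attractedPostcriticalSet P).Countable :=
  ((finite_attracted_critical hne).countable.biUnion fun _ _ =>
    (countable_range _).insert 0).insert 0

theorem attractedPostcriticalSet_subset (h0 : P.eval 0 = 0) :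
    attractedPostcriticalSet P ⊆ attractingBasin (fun z => P.eval z) 0 := by
  have h : (0 : ℂ) ∈ attractingBasin (fun z => P.eval z) 0 := mem_attractingBasin_self h0
  refine insert_subset h (iUnion₂_subset fun c hc => insert_subset h ?_)
  rintro _ ⟨j, rfl⟩
  exact iterate_mem_attractingBasin.2 hc.2

/-- By the chain rule a critical point of `f^n` passes through a critical point of `f` before time
`n`. One set, independent of `n`, therefore contains the critical values of all iterates in the
basin. -/
theorem derivative_iterate_eval_ne_zero {n : ℕ} {y : ℂ}
    (hy : (fun z => P.eval z)^[n] y ∈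
      attractingBasin (fun z => P.eval z) 0 \ attractedPostcriticalSet P) :
    (P.comp^[n] X).derivative.eval y ≠ 0 := by
  intro h
  obtain ⟨k, hk, hc⟩ := exists_eq_zero_of_derivative_iterate_eq_zero h
  obtain ⟨j, rfl⟩ : ∃ j, n = (j + 1) + k := ⟨n - k - 1, by omega⟩
  rw [Function.iterate_add_apply] at hy
  exact hy.2 (Or.inr (mem_biUnion (show _ ∈ {c | P.derivative.eval c = 0 ∧ _} from
    ⟨hc, iterate_mem_attractingBasin.1 hy.1⟩) (Or.inr ⟨j, rfl⟩)))

/-- Chains of disks avoiding the critical values of a polynomial lift through it. -/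
theorem exists_discChain_lift (q : Polynomial ℂ) {W Ω : Set ℂ}
    (hcrit : ∀ y, q.eval y ∈ W → q.derivative.eval y ≠ 0)
    (hΩ : ∀ T : Set ℂ, IsPreconnected T → MapsTo (fun z => q.eval z) T W →
      (T ∩ Ω).Nonempty → T ⊆ Ω)
    {n : ℕ} {x a : ℂ} (h : DiscChain W n x a) {y : ℂ} (hy : y ∈ Ω) (hyx : q.eval y = x) :
    ∃ y' ∈ Ω, q.eval y' = a ∧ DiscChain Ω n y y' := by
  induction h generalizing y with
  | nil p => exact ⟨y, hy, hyx, .nil y⟩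
  | cons hl _ ih =>
    obtain ⟨f, hf, hfW, h0, s, hs, h1⟩ := hl
    obtain ⟨F, hF, hF0, hqF⟩ := q.exists_disc_lift hf
      (fun y ⟨ζ, hζ, hyζ⟩ => hcrit y (hyζ ▸ hfW hζ)) (hyx.trans h0.symm)
    have hmaps : MapsTo F (Metric.ball 0 1) Ω := by
      rw [mapsTo_iff_image_subset]
      refine hΩ _ (Metric.isPreconnected_ball.image F hF.continuousOn) ?_
        ⟨y, ⟨0, by simp, hF0⟩, hy⟩
      rintro _ ⟨ζ, hζ, rfl⟩
      simpa only [hqF ζ hζ] using hfW hζ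
    have hsb : s ∈ Metric.ball (0 : ℂ) 1 := by
      rw [mem_ball_zero_iff]
      linarith
    obtain ⟨y', hy', hqy', hch⟩ := ih (hmaps hsb) ((hqF s hsb).trans h1)
    exact ⟨y', hy', hqy', .cons ⟨F, hF, hmaps, hF0, s, hs, rfl⟩ hch⟩

/-- Every point of the immediate basin is joined to an iterated preimage of the attracting fixed
point by a chain of disks of bounded length. -/
theorem exists_discChain_to_backwardOrbit (hdeg : 2 ≤ P.natDegree) (h0 : P.eval 0 = 0)
    (hpos : 0 < ‖P.derivative.eval 0‖) (hlt : ‖P.derivative.eval 0‖ < 1) :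
    ∃ N, ∀ z ∈ immediateBasin (fun z => P.eval z) 0,
      ∃ y ∈ immediateBasin (fun z => P.eval z) 0, ∃ k : ℕ, (fun z => P.eval z)^[k] y = 0 ∧
        DiscChain (immediateBasin (fun z => P.eval z) 0) N z y := by
  obtain ⟨r, hr⟩ := exists_isTrappingRadius h0 hpos hlt
  obtain ⟨b, hbΩ, hb0, hPb⟩ := exists_ne_zero_eval_eq_zero hdeg h0 hpos hlt hr
  have hne : P.derivative ≠ 0 := fun h => by simp [h] at hpos
  set f : ℂ → ℂ := fun z => P.eval z with hf
  set Ω := immediateBasin f 0 with hΩ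
  set S := attractedPostcriticalSet P with hS
  have hfc : Continuous f := P.continuous
  have hΩo : IsOpen Ω := hr.isOpen_immediateBasin hfc
  have hΩc : IsPreconnected Ω := isPreconnected_immediateBasin
  have h0Ω : (0 : ℂ) ∈ Ω := mem_immediateBasin_self h0
  have hGo : ∀ n : ℕ, IsOpen {z | ‖f^[n] z‖ < r} := fun n =>
    isOpen_lt (hfc.iterate n).norm continuous_const
  have hScompact : IsCompact S := isCompact_attractedPostcriticalSet hne
  obtain ⟨M, hM⟩ : ∃ M : ℕ, S ⊆ {z | ‖f^[M] z‖ < r} := by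
    refine hScompact.elim_directed_cover _ hGo (fun z hz => ?_)
      (Monotone.directed_le fun n m hnm z hz => hr.norm_iterate_lt_of_le hnm hz)
    exact mem_iUnion.2 (hr.exists_norm_iterate_lt (attractedPostcriticalSet_subset h0 hz))
  obtain ⟨a, haΩ, hab⟩ := exists_iterate_eq_of_mem_immediateBasin hdeg h0 hr M hbΩ
  -- `b` is a nonzero zero of `P`, hence outside the trapping disk.
  have haG : ¬ ‖f^[M] a‖ < r := fun h => hb0 (hr.eq_zero b (hab ▸ h.le) hPb)
  have ha0 : f^[M + 1] a = 0 := by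
    rw [Function.iterate_succ_apply', hab]
    exact hPb
  have hWo : IsOpen (Ω \ S) := hΩo.sdiff hScompact.isClosed
  have hWc : IsPreconnected (Ω \ S) :=
    hΩc.diff_countable hΩo (countable_attractedPostcriticalSet hne)
  have hK : ∀ n : ℕ, IsCompact ({z | ‖f^[n] z‖ ≤ r} ∩ Ω) := fun n =>
    (isCompact_iterate_preimage_closedBall hdeg n r).inter_immediateBasin h0
      fun z hz => hr.mem_basin_of_norm_iterate_le hz
  -- This compact set is a fundamental shell: every orbit in `Ω` starting outside `{‖f^M‖ < r}`
  -- meets it just before entering.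
  obtain ⟨N₁, hN₁⟩ := ((hK (M + 1)).diff (hGo M)).exists_discChain (W := Ω \ S)
    (fun x hx => ⟨hx.1.2, fun hxS => hx.2 (hM hxS)⟩) hWo hWc ⟨haΩ, fun h => haG (hM h)⟩
  obtain ⟨N₂, hN₂⟩ := (hK M).exists_discChain inter_subset_right hΩo hΩc h0Ω
  refine ⟨max N₁ N₂, fun z hz => ?_⟩
  by_cases hzG : ‖f^[M] z‖ < r
  · exact ⟨0, h0Ω, 0, rfl, (hN₂ z ⟨hzG.le, hz⟩).mono hz (le_max_right _ _)⟩
  obtain ⟨k, hk, hk'⟩ : ∃ k : ℕ, ¬ ‖f^[M] (f^[k] z)‖ < r ∧ ‖f^[M] (f^[k + 1] z)‖ < r := by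
    by_contra! hall
    have hnot : ∀ k, ¬ ‖f^[M] (f^[k] z)‖ < r := by
      intro k
      induction k with
      | zero => exact hzG
      | succ k ih => exact not_lt.2 (hall k (not_lt.1 ih))
    obtain ⟨n, hn⟩ := hr.exists_norm_iterate_lt (immediateBasin_subset hz)
    refine hnot n ?_
    rw [← Function.iterate_add_apply]
    exact hr.norm_iterate_lt_of_le (Nat.le_add_left n M) hn
  have hchain := hN₁ (f^[k] z) ⟨⟨?_, iterate_mem_immediateBasin hfc h0 k hz⟩, hk⟩
  · obtain ⟨y, hyΩ, hya, hch⟩ := exists_discChain_lift (P.comp^[k] X) (W := Ω \ S) (Ω := Ω)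
      (fun y hy => derivative_iterate_eval_ne_zero
        (by rw [← eval_iterate_comp_X]; exact ⟨immediateBasin_subset hy.1, hy.2⟩))
      (fun T hT hTW hTΩ => hT.subset_immediateBasin (fun y hy => by
        have h1 := immediateBasin_subset (hTW hy).1
        simp only [eval_iterate_comp_X] at h1
        exact iterate_mem_attractingBasin.1 h1) hTΩ)
      hchain hz (eval_iterate_comp_X P k z)
    refine ⟨y, hyΩ, M + 1 + k, ?_, hch.mono hz (le_max_left _ _)⟩
    rw [Function.iterate_add_apply, ← ha0, ← hya, eval_iterate_comp_X]
  · rw [Function.iterate_succ_apply', ← Function.iterate_succ_apply] at hk'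
    exact hk'.le

end Polynomial

/-! ### Products and conclusion. -/

section Product

variable {E E' : Type*} [NormedAddCommGroup E] [NormedSpace ℂ E] [NormedAddCommGroup E']
  [NormedSpace ℂ E']

theorem DiscLinked.map {g : E → E'} (hg : Differentiable ℂ g) {Ω : Set E} {Ω' : Set E'}
    (hΩ : MapsTo g Ω Ω') {p q : E} (h : DiscLinked Ω p q) : DiscLinked Ω' (g p) (g q) := by
  obtain ⟨f, hf, hm, rfl, s, hs, rfl⟩ := h
  exact ⟨g ∘ f, hg.comp_differentiableOn hf, hΩ.comp hm, rfl, s, hs, rfl⟩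

theorem DiscChain.map {g : E → E'} (hg : Differentiable ℂ g) {Ω : Set E} {Ω' : Set E'}
    (hΩ : MapsTo g Ω Ω') {n : ℕ} {p q : E} (h : DiscChain Ω n p q) :
    DiscChain Ω' n (g p) (g q) := by
  induction h with
  | nil p => exact .nil _
  | cons hl _ ih => exact .cons (hl.map hg hΩ) ih

/-- The coordinates move one at a time, so the lengths add. -/
theorem DiscChain.prod {Ω : Set E} {Ω' : Set E'} {n m : ℕ} {p q : E} {p' q' : E'}
    (h : DiscChain Ω n p q) (h' : DiscChain Ω' m p' q') (hp' : p' ∈ Ω') (hq : q ∈ Ω) :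
    DiscChain (Ω ×ˢ Ω') (m + n) (p, p') (q, q') := by
  have h₁ : MapsTo (fun z => (z, p')) Ω (Ω ×ˢ Ω') := fun _ hz => ⟨hz, hp'⟩
  have h₂ : MapsTo (fun w => (q, w)) Ω' (Ω ×ˢ Ω') := fun _ hw => ⟨hq, hw⟩
  exact (h.map (by fun_prop) h₁).trans (h'.map (by fun_prop) h₂)

end Product

theorem productMap_iterate (P Q : Polynomial ℂ) (n : ℕ) (x : ℂ × ℂ) :
    (productMap P Q)^[n] x = ((fun z => P.eval z)^[n] x.1, (fun w => Q.eval w)^[n] x.2) := by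
  induction n with
  | zero => rfl
  | succ n ih => simp only [Function.iterate_succ_apply', ih, productMap]

theorem attractingBasin_productMap (P Q : Polynomial ℂ) (a b : ℂ) :
    attractingBasin (productMap P Q) (a, b) =
      attractingBasin (fun z => P.eval z) a ×ˢ attractingBasin (fun w => Q.eval w) b := by
  ext x
  simp only [attractingBasin, mem_ofPred_eq, mem_prod, productMap_iterate, Prod.tendsto_iff]

/-- Projections and products of connected sets are connected. -/
theorem immediateBasin_productMap {P Q : Polynomial ℂ} {a b : ℂ} (ha : P.eval a = a)
    (hb : Q.eval b = b) :
    immediateBasin (productMap P Q) (a, b) =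
      immediateBasin (fun z => P.eval z) a ×ˢ immediateBasin (fun w => Q.eval w) b := by
  have ha' : a ∈ immediateBasin (fun z => P.eval z) a := mem_immediateBasin_self ha
  have hb' : b ∈ immediateBasin (fun w => Q.eval w) b := mem_immediateBasin_self hb
  have hab : (a, b) ∈ immediateBasin (productMap P Q) (a, b) :=
    mem_immediateBasin_self (by simp [productMap, ha, hb])
  have hsub : immediateBasin (productMap P Q) (a, b) ⊆
      attractingBasin (fun z => P.eval z) a ×ˢ attractingBasin (fun w => Q.eval w) b :=
    attractingBasin_productMap P Q a b ▸ immediateBasin_subset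
  refine Subset.antisymm (fun x hx => ⟨?_, ?_⟩) ?_
  · exact IsPreconnected.subset_immediateBasin
      (isPreconnected_immediateBasin.image Prod.fst continuous_fst.continuousOn)
      (by rintro _ ⟨y, hy, rfl⟩; exact (hsub hy).1) ⟨a, ⟨_, hab, rfl⟩, ha'⟩ ⟨x, hx, rfl⟩
  · exact IsPreconnected.subset_immediateBasin
      (isPreconnected_immediateBasin.image Prod.snd continuous_snd.continuousOn)
      (by rintro _ ⟨y, hy, rfl⟩; exact (hsub hy).2) ⟨b, ⟨_, hab, rfl⟩, hb'⟩ ⟨x, hx, rfl⟩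
  · refine IsPreconnected.subset_immediateBasin
      (isPreconnected_immediateBasin.prod isPreconnected_immediateBasin) ?_
      ⟨(a, b), ⟨ha', hb'⟩, hab⟩
    rw [attractingBasin_productMap]
    exact prod_mono immediateBasin_subset immediateBasin_subset

theorem theorem3p2 (P Q : Polynomial ℂ) (hPdeg : 2 ≤ P.natDegree) (hQdeg : 2 ≤ Q.natDegree)
    (hP0 : P.eval 0 = 0) (hQ0 : Q.eval 0 = 0)
    (hP'pos : 0 < ‖P.derivative.eval 0‖) (hP'lt : ‖P.derivative.eval 0‖ < 1)
    (hQ'pos : 0 < ‖Q.derivative.eval 0‖) (hQ'lt : ‖Q.derivative.eval 0‖ < 1) :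
    ∃ C : ℝ≥0, ∀ x ∈ immediateBasin (productMap P Q) (0, 0),
      ∃ y ∈ backwardOrbit (productMap P Q) (0, 0),
        y ∈ immediateBasin (productMap P Q) (0, 0) ∧
          kobayashiDist (immediateBasin (productMap P Q) (0, 0)) x y ≤ (C : ℝ≥0∞) := by
  obtain ⟨N, hN⟩ := P.exists_discChain_to_backwardOrbit hPdeg hP0 hP'pos hP'lt
  obtain ⟨M, hM⟩ := Q.exists_discChain_to_backwardOrbit hQdeg hQ0 hQ'pos hQ'lt
  refine ⟨(M + N + 1 : ℕ), ?_⟩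
  rw [immediateBasin_productMap hP0 hQ0]
  rintro ⟨z, w⟩ ⟨hz, hw⟩
  obtain ⟨z', hz', j, hj, hzz'⟩ := hN z hz
  obtain ⟨w', hw', k, hk, hww'⟩ := hM w hw
  refine ⟨(z', w'), ?_, ⟨hz', hw'⟩, ?_⟩
  -- Since `0` is fixed by both polynomials, `k + j` iterations send both coordinates to `0`.
  · refine mem_iUnion.2 ⟨k + j, ?_⟩
    rw [mem_preimage, mem_singleton_iff, productMap_iterate]
    refine Prod.ext ?_ ?_
    · simp only [Function.iterate_add_apply, hj]
      exact Function.iterate_fixed hP0 k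
    · simp only [add_comm k j, Function.iterate_add_apply, hk]
      exact Function.iterate_fixed hQ0 j
  · exact_mod_cast (hzz'.prod hww' hw hz').kobayashiDist_le ⟨hz, hw⟩
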